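/- Let $0<q<1$ and let $\nu>-1$ be real. Write $(a;p)_n=\prod_{i=0}^{n-1}(1-ap^i)$ for $n\in\{0,1,2,\dots\}\cup\{\infty\}$, and let $$j_\nu(x,q^2)=\sum_{n=0}^\infty(-1)^n\frac{q^{n(n+1)}}{(q^2;q^2)_n(q^{2\nu+2};q^2)_n}x^{2n},\qquad c_{q,\nu}=\frac1{1-q}\,\frac{(q^{2\nu+2};q^2)_\infty}{(q^2;q^2)_\infty}.$$ With Jackson's $q$-integral $\int_0^\infty f(t)\,d_qt=(1-q)\sum_{n\in\mathbb Z}q^nf(q^n)$, the $q$-Macdonald function is $$K_\nu(x,q^2)=c_{q,\nu}\int_0^\infty\frac{j_\nu(tx,q^2)}{1+t^2}\,t^{2\nu+1}\,d_qt .$$ Then: (i) the sequence $K_\nu(q^{-n},q^2)$ has a constant (strict) sign for all sufficiently large $n$, that is, either $K_\nu(q^{-n},q^2)>0$ for all large $n$ or $K_\nu(q^{-n},q^2)<0$ for all large $n$, and $$\lim_{n\to\infty}\frac{K_\nu(q^{-n},q^2)}{K_\nu(q^{-n+1},q^2)}=0;$$ (ii) there exist $c,\sigma>0$ such that $|K_\nu(q^{-n},q^2)|<\sigma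 c^nq^{n^2}$ for all sufficiently large $n$. -/

import Mathlib

noncomputable section

namespace QBessel

/-- The finite `q`-shifted factorial `(a;q)_n = ∏_{i<n} (1 - a q^i)`. -/
def qPoch (a q : ℝ) (n : ℕ) : ℝ := ∏ i ∈ Finset.range n, (1 - a * q ^ i)

/-- The infinite `q`-shifted factorial `(a;q)_∞ = ∏_{i≥0} (1 - a q^i)`. -/
def qPochInf (a q : ℝ) : ℝ := ∏' i : ℕ, (1 - a * q ^ i)

/-- The normalized third Jackson (Hahn-Exton) `q`-Bessel function
`j_ν(x;q) = ∑_{n≥0} (-1)^n q^{n(n+1)/2} / ((q;q)_n (q^{ν+1};q)_n) x^{2n}`. -/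
def jNorm (ν x q : ℝ) : ℝ :=
  ∑' n : ℕ, (-1 : ℝ) ^ n * (q ^ (n * (n + 1) / 2) / (qPoch q q n * qPoch (q ^ (ν + 1)) q n))
    * x ^ (2 * n)

/-- Jackson's `q`-integral `∫_0^∞ f(t) d_q t = (1 - q) ∑_{n∈ℤ} q^n f(q^n)`. -/
def jacksonIntegral (q : ℝ) (f : ℝ → ℝ) : ℝ := (1 - q) * ∑' n : ℤ, q ^ n * f (q ^ n)

/-- The constant `c_{q,ν} = (1/(1-q)) (q^{2ν+2};q²)_∞ / (q²;q²)_∞`. -/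
def cConst (q ν : ℝ) : ℝ :=
  1 / (1 - q) * (qPochInf (q ^ (2 * ν + 2)) (q ^ 2) / qPochInf (q ^ 2) (q ^ 2))

/-- The `q`-Macdonald function
`K_ν(x,q²) = c_{q,ν} ∫_0^∞ (1 + t²)⁻¹ j_ν(tx,q²) t^{2ν+1} d_q t`. The argument is `q`, not `q²`. -/
def qMacdonald (q ν x : ℝ) : ℝ :=
  cConst q ν * jacksonIntegral q
    (fun t => (1 + t ^ 2)⁻¹ * jNorm ν (t * x) (q ^ 2) * t ^ (2 * ν + 1))

end QBessel

end

noncomputable section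

namespace QBessel

open Filter Topology Finset

/-! ### `q`-shifted factorials -/

/-! Put `p = q²`, `a = p^(ν+1)`, `s = a/p`. On the lattice `x = q^(-N)` the function is a positive
constant times `F N = macdonaldSum p a N`, and everything follows from a recurrence in `N`.

The `q`-Bessel equation produces a factor `p^(k-N) = p^(-N) p^k` under the sum. Since `p^k/(1+p^k) =
1 - 1/(1+p^k)` and `∑ a^k J(p^(k-N)) = 0` (a telescoping sum), this term changes sign, leaving
`F(N+1) + s F(N-1) = (1+s+p^(-N)) F N`. The Euler-type transformation of the series supplies the
decay of `J` that makes the sums converge, and it gives `F N → 0`.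

A decaying solution that is not identically zero obeys a discrete maximum principle: it has constant
sign and `|F|` strictly decreases, so `p^(-N)|F N| < s|F(N-1)|`. This gives the ratio limit, and its
iteration gives the bound. Nontriviality is direct for `p ≤ a`; smaller `a` reduces to that case by
a contiguous relation. -/

lemma qPoch_succ (a p : ℝ) (n : ℕ) : qPoch a p (n + 1) = qPoch a p n * (1 - a * p ^ n) := by
  simp [qPoch, Finset.prod_range_succ]

lemma qPoch_succ' (a p : ℝ) (n : ℕ) : qPoch a p (n + 1) = (1 - a) * qPoch (a * p) p n := by
  simp only [qPoch, Finset.prod_range_succ', pow_zero, mul_one]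
  rw [mul_comm]
  congr 1
  exact Finset.prod_congr rfl fun i _ => by ring

lemma one_sub_mul_pow_pos {a p : ℝ} (hp0 : 0 < p) (hp1 : p < 1) (ha : a < 1) (i : ℕ) :
    0 < 1 - a * p ^ i := by
  have h1 : 0 < p ^ i := by positivity
  have h2 : p ^ i ≤ 1 := pow_le_one₀ hp0.le hp1.le
  nlinarith

lemma qPoch_pos {a p : ℝ} (hp0 : 0 < p) (hp1 : p < 1) (ha : a < 1) (n : ℕ) : 0 < qPoch a p n :=
  Finset.prod_pos fun i _ => one_sub_mul_pow_pos hp0 hp1 ha i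

lemma summable_norm_neg_mul_pow {p : ℝ} (hp0 : 0 < p) (hp1 : p < 1) (a : ℝ) :
    Summable fun i : ℕ => ‖-(a * p ^ i)‖ := by
  have := ((summable_geometric_of_lt_one hp0.le hp1).mul_left |a|)
  refine this.congr fun i => ?_
  rw [norm_neg, Real.norm_eq_abs, abs_mul, abs_of_pos (by positivity : 0 < p ^ i)]

lemma multipliable_qPochInf {p : ℝ} (hp0 : 0 < p) (hp1 : p < 1) (a : ℝ) :
    Multipliable fun i : ℕ => 1 - a * p ^ i := by
  simpa [sub_eq_add_neg] using
    multipliable_one_add_of_summable (summable_norm_neg_mul_pow hp0 hp1 a)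

lemma tendsto_qPoch {p : ℝ} (hp0 : 0 < p) (hp1 : p < 1) (a : ℝ) :
    Tendsto (qPoch a p) atTop (𝓝 (qPochInf a p)) :=
  (multipliable_qPochInf hp0 hp1 a).hasProd.tendsto_prod_nat

lemma qPochInf_pos {a p : ℝ} (hp0 : 0 < p) (hp1 : p < 1) (ha : a < 1) : 0 < qPochInf a p := by
  refine lt_of_le_of_ne (ge_of_tendsto' (tendsto_qPoch hp0 hp1 a)
    fun n => (qPoch_pos hp0 hp1 ha n).le) (Ne.symm ?_)
  have := tprod_one_add_ne_zero_of_summable (f := fun i : ℕ => -(a * p ^ i))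
    (fun i => by
      have := one_sub_mul_pow_pos hp0 hp1 ha i
      rw [← sub_eq_add_neg]; exact this.ne') (summable_norm_neg_mul_pow hp0 hp1 a)
  simpa [qPochInf, sub_eq_add_neg] using this

lemma qPochInf_le_qPoch {a p : ℝ} (hp0 : 0 < p) (hp1 : p < 1) (ha0 : 0 ≤ a) (ha : a < 1)
    (n : ℕ) : qPochInf a p ≤ qPoch a p n := by
  have hanti : Antitone (qPoch a p) := by
    refine antitone_nat_of_succ_le fun k => ?_
    rw [qPoch_succ]
    have h1 := qPoch_pos hp0 hp1 ha k
    have h2 : 0 ≤ a * p ^ k := by positivity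
    nlinarith
  exact hanti.le_of_tendsto (tendsto_qPoch hp0 hp1 a) n

lemma qPochInf_le_one {a p : ℝ} (hp0 : 0 < p) (hp1 : p < 1) (ha0 : 0 ≤ a) (ha : a < 1) :
    qPochInf a p ≤ 1 := by
  simpa [qPoch] using qPochInf_le_qPoch hp0 hp1 ha0 ha 0

lemma qPoch_mul_qPochInf {p : ℝ} (hp0 : 0 < p) (hp1 : p < 1) (a : ℝ) (n : ℕ) :
    qPoch a p n * qPochInf (a * p ^ n) p = qPochInf a p := by
  have hshift : ∀ i : ℕ, 1 - a * p ^ n * p ^ i = 1 - a * p ^ (i + n) := fun i => by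
    rw [pow_add]; ring
  have h := multipliable_qPochInf hp0 hp1 (a * p ^ n)
  simp only [hshift] at h
  have key := Multipliable.prod_mul_tprod_nat_mul' (f := fun i : ℕ => 1 - a * p ^ i) (k := n) h
  simp only [qPoch, qPochInf, hshift]
  exact key

/-- The factor with index `-j` vanishes. This truncates the transformed series at negative lattice
points, where the original series alternates with large terms. -/
lemma qPochInf_zpow_of_nonpos {p : ℝ} (hp0 : 0 < p) {j : ℤ} (hj : j ≤ 0) :
    qPochInf (p ^ j) p = 0 := by
  refine tprod_of_exists_eq_zero ⟨j.natAbs, ?_⟩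
  rw [← zpow_natCast, ← zpow_add₀ hp0.ne']
  have : j + (j.natAbs : ℤ) = 0 := by omega
  rw [this, zpow_zero, sub_self]

lemma qPochInf_zpow_mem {p : ℝ} (hp0 : 0 < p) (hp1 : p < 1) (j : ℤ) :
    0 ≤ qPochInf (p ^ j) p ∧ qPochInf (p ^ j) p ≤ 1 := by
  rcases le_or_gt j 0 with hj | hj
  · simp [qPochInf_zpow_of_nonpos hp0 hj]
  · have h : p ^ j < 1 := zpow_lt_one₀ hp0 hp1 hj
    have h0 : 0 < p ^ j := zpow_pos hp0 j
    exact ⟨(qPochInf_pos hp0 hp1 h).le, qPochInf_le_one hp0 hp1 h0.le h⟩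

/-! ### Series with quadratic exponents -/

lemma triangle_succ (n : ℕ) : (n + 1) * (n + 1 + 1) / 2 = n * (n + 1) / 2 + (n + 1) := by
  have : (n + 1) * (n + 1 + 1) = n * (n + 1) + (n + 1) * 2 := by ring
  rw [this, Nat.add_mul_div_right _ _ (by norm_num)]

lemma summable_pow_triangle {p : ℝ} (hp0 : 0 < p) (hp1 : p < 1) {r : ℝ} (hr : 0 ≤ r) :
    Summable fun n : ℕ => p ^ (n * (n + 1) / 2) * r ^ n := by
  rcases hr.eq_or_lt with rfl | hr
  · refine summable_of_ne_finset_zero (s := {0}) fun n hn => ?_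
    rw [zero_pow (by simpa using hn), mul_zero]
  refine summable_of_ratio_test_tendsto_lt_one (l := 0) zero_lt_one
    (Eventually.of_forall fun n => by positivity) ?_
  have h : Tendsto (fun n : ℕ => p * r * p ^ n) atTop (𝓝 (p * r * 0)) :=
    (tendsto_pow_atTop_nhds_zero_of_lt_one hp0.le hp1).const_mul _
  rw [mul_zero] at h
  refine h.congr fun n => ?_
  rw [Real.norm_of_nonneg (by positivity), Real.norm_of_nonneg (by positivity), triangle_succ]
  field_simp
  ring

/-- The coefficients of Euler's expansion of `y ↦ (p y; p)_∞`. -/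
def eulerCoeff (p : ℝ) (n : ℕ) : ℝ := (-1) ^ n * (p ^ (n * (n + 1) / 2) / qPoch p p n)

lemma eulerCoeff_succ {p : ℝ} (hp0 : 0 < p) (hp1 : p < 1) (n : ℕ) :
    eulerCoeff p (n + 1) * (1 - p ^ (n + 1)) = -p ^ (n + 1) * eulerCoeff p n := by
  have h1 := (qPoch_pos hp0 hp1 hp1 n).ne'
  have h2 := (one_sub_mul_pow_pos hp0 hp1 hp1 n).ne'
  rw [eulerCoeff, eulerCoeff, qPoch_succ, triangle_succ, ← pow_succ']
  rw [← pow_succ'] at h2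
  field_simp
  ring

lemma abs_eulerCoeff_le {p : ℝ} (hp0 : 0 < p) (hp1 : p < 1) (n : ℕ) :
    |eulerCoeff p n| ≤ (qPochInf p p)⁻¹ * p ^ (n * (n + 1) / 2) := by
  have h0 := qPochInf_pos hp0 hp1 hp1
  have h1 := qPoch_pos hp0 hp1 hp1 n
  rw [eulerCoeff, abs_mul, abs_pow, abs_neg, abs_one, one_pow, one_mul, abs_of_pos (by positivity),
    div_eq_inv_mul]
  gcongr
  exact qPochInf_le_qPoch hp0 hp1 hp0.le hp1 n

lemma summable_abs_eulerCoeff {p : ℝ} (hp0 : 0 < p) (hp1 : p < 1) {r : ℝ} (hr : 0 ≤ r) :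
    Summable fun n : ℕ => |eulerCoeff p n| * r ^ n := by
  refine Summable.of_nonneg_of_le (fun n => by positivity) (fun n => ?_)
    ((summable_pow_triangle hp0 hp1 hr).mul_left (qPochInf p p)⁻¹)
  rw [← mul_assoc]
  exact mul_le_mul_of_nonneg_right (abs_eulerCoeff_le hp0 hp1 n) (by positivity)

lemma summable_eulerCoeff {p : ℝ} (hp0 : 0 < p) (hp1 : p < 1) (y : ℝ) :
    Summable fun n : ℕ => eulerCoeff p n * y ^ n := by
  refine Summable.of_norm ((summable_abs_eulerCoeff hp0 hp1 (abs_nonneg y)).congr fun n => ?_)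
  rw [Real.norm_eq_abs, abs_mul, abs_pow]

/-- A power series bounded by an absolutely convergent one at `1` tends to its constant term
along `y p^n`. -/
lemma tendsto_tsum_mul_pow_pow {c : ℕ → ℝ} {p y : ℝ} (hp0 : 0 < p) (hp1 : p < 1)
    (hc : Summable fun n : ℕ => |c n| * |y| ^ n) :
    Tendsto (fun N : ℕ => ∑' n : ℕ, c n * (y * p ^ N) ^ n) atTop (𝓝 (c 0)) := by
  have h0 : ∑' n : ℕ, (if n = 0 then c 0 else 0) = c 0 := tsum_ite_eq 0 _
  rw [← h0]
  refine tendsto_tsum_of_dominated_convergence hc (fun n => ?_) (Eventually.of_forall fun N n => ?_)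
  · rcases eq_or_ne n 0 with rfl | hn
    · simp
    · have : Tendsto (fun N : ℕ => c n * (y * p ^ N) ^ n) atTop (𝓝 (c n * (y * 0) ^ n)) :=
        (((tendsto_pow_atTop_nhds_zero_of_lt_one hp0.le hp1).const_mul y).pow n).const_mul _
      simpa [hn] using this
  · rw [Real.norm_eq_abs, abs_mul, abs_pow, abs_mul, abs_of_pos (pow_pos hp0 N)]
    gcongr
    exact mul_le_of_le_one_right (abs_nonneg y) (pow_le_one₀ hp0.le hp1.le)

/-- Euler's expansion of the infinite `q`-shifted factorial. -/
theorem tsum_eulerCoeff {p : ℝ} (hp0 : 0 < p) (hp1 : p < 1) (y : ℝ) :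
    ∑' n : ℕ, eulerCoeff p n * y ^ n = qPochInf (p * y) p := by
  set E : ℝ → ℝ := fun y => ∑' n : ℕ, eulerCoeff p n * y ^ n with hE
  -- The functional equation is iterated down to `y p^N → 0`, where the series tends to its constant
  -- term.
  have hstep : ∀ y, E y = (1 - p * y) * E (p * y) := by
    intro y
    have hs := summable_eulerCoeff hp0 hp1 y
    have hs' := summable_eulerCoeff hp0 hp1 (p * y)
    have h1 : E y - E (p * y) = ∑' n : ℕ, -(p * y) * (eulerCoeff p n * (p * y) ^ n) := by
      rw [hE, ← hs.tsum_sub hs', (hs.sub hs').tsum_eq_zero_add]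
      simp only [pow_zero, sub_self, zero_add]
      refine tsum_congr fun n => ?_
      have := eulerCoeff_succ hp0 hp1 n
      rw [mul_pow p y (n + 1), mul_pow p y n]
      linear_combination y ^ (n + 1) * this
    rw [tsum_mul_left] at h1
    change E y - E (p * y) = -(p * y) * E (p * y) at h1
    linear_combination h1
  have hiter : ∀ N : ℕ, E y = qPoch (p * y) p N * E (y * p ^ N) := by
    intro N
    induction N with
    | zero => simp [qPoch]
    | succ N ih =>
      rw [ih, hstep (y * p ^ N), qPoch_succ, pow_succ]
      ring_nf
  have hlim : Tendsto (fun N : ℕ => qPoch (p * y) p N * E (y * p ^ N)) atTop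
      (𝓝 (qPochInf (p * y) p * eulerCoeff p 0)) :=
    (tendsto_qPoch hp0 hp1 _).mul (tendsto_tsum_mul_pow_pow hp0 hp1
      (summable_abs_eulerCoeff hp0 hp1 (abs_nonneg y)))
  have h0 : eulerCoeff p 0 = 1 := by simp [eulerCoeff, qPoch]
  rw [h0, mul_one] at hlim
  exact tendsto_nhds_unique (tendsto_const_nhds.congr hiter) hlim

/-! ### The series `₁φ₁(0; a; p, p z)` -/

/-- The coefficients of `₁φ₁(0; a; p, p z)` as a power series in `z`. -/
def besselCoeff (p a : ℝ) (n : ℕ) : ℝ := eulerCoeff p n / qPoch a p n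

/-- The series `₁φ₁(0; a; p, p z)`. -/
def besselSeries (p a z : ℝ) : ℝ := ∑' n : ℕ, besselCoeff p a n * z ^ n

lemma besselCoeff_zero (p a : ℝ) : besselCoeff p a 0 = 1 := by
  simp [besselCoeff, eulerCoeff, qPoch]

section

variable {p a : ℝ}

lemma besselCoeff_succ (hp0 : 0 < p) (hp1 : p < 1) (ha1 : a < 1) (n : ℕ) :
    besselCoeff p a (n + 1) * ((1 - p ^ (n + 1)) * (1 - a * p ^ n)) =
      -p ^ (n + 1) * besselCoeff p a n := by
  have h1 := (qPoch_pos hp0 hp1 ha1 n).ne'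
  have h2 := (one_sub_mul_pow_pos hp0 hp1 ha1 n).ne'
  have h3 := eulerCoeff_succ hp0 hp1 n
  rw [besselCoeff, besselCoeff, qPoch_succ]
  field_simp
  linear_combination h3

lemma summable_abs_besselCoeff (hp0 : 0 < p) (hp1 : p < 1) (ha0 : 0 < a) (ha1 : a < 1) {r : ℝ}
    (hr : 0 ≤ r) : Summable fun n : ℕ => |besselCoeff p a n| * r ^ n := by
  refine Summable.of_nonneg_of_le (fun n => by positivity) (fun n => ?_)
    ((summable_abs_eulerCoeff hp0 hp1 hr).mul_left (qPochInf a p)⁻¹)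
  have h0 := qPochInf_pos hp0 hp1 ha1
  rw [besselCoeff, abs_div, abs_of_pos (qPoch_pos hp0 hp1 ha1 n), ← mul_assoc, div_eq_inv_mul]
  gcongr
  exact qPochInf_le_qPoch hp0 hp1 ha0.le ha1 n

lemma summable_besselCoeff (hp0 : 0 < p) (hp1 : p < 1) (ha0 : 0 < a) (ha1 : a < 1) (z : ℝ) :
    Summable fun n : ℕ => besselCoeff p a n * z ^ n := by
  refine Summable.of_norm
    ((summable_abs_besselCoeff hp0 hp1 ha0 ha1 (abs_nonneg z)).congr fun n => ?_)
  rw [Real.norm_eq_abs, abs_mul, abs_pow]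

lemma tendsto_besselSeries (hp0 : 0 < p) (hp1 : p < 1) (ha0 : 0 < a) (ha1 : a < 1) :
    Tendsto (fun N : ℕ => besselSeries p a (p ^ N)) atTop (𝓝 1) := by
  have := tendsto_tsum_mul_pow_pow (y := 1) hp0 hp1
    (summable_abs_besselCoeff hp0 hp1 ha0 ha1 (abs_nonneg 1))
  simpa [besselCoeff_zero, besselSeries] using this

/-- The second order `q`-difference equation. -/
lemma besselSeries_recurrence (hp0 : 0 < p) (hp1 : p < 1) (ha0 : 0 < a) (ha1 : a < 1) (z : ℝ) :
    besselSeries p a z - besselSeries p a (p * z) -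
      a / p * (besselSeries p a (p * z) - besselSeries p a (p * (p * z))) =
      -(p * z) * besselSeries p a (p * z) := by
  have h0 := summable_besselCoeff hp0 hp1 ha0 ha1 z
  have h1 := summable_besselCoeff hp0 hp1 ha0 ha1 (p * z)
  have h2 := summable_besselCoeff hp0 hp1 ha0 ha1 (p * (p * z))
  have hs := (h0.sub h1).sub ((h1.sub h2).mul_left (a / p))
  simp only [besselSeries]
  rw [← h0.tsum_sub h1, ← h1.tsum_sub h2, ← tsum_mul_left,
    ← (h0.sub h1).tsum_sub ((h1.sub h2).mul_left (a / p)), hs.tsum_eq_zero_add, ← tsum_mul_left]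
  simp only [pow_zero, sub_self, mul_zero, zero_add]
  refine tsum_congr fun n => ?_
  have h := besselCoeff_succ hp0 hp1 ha1 n
  have hp : a / p * p ^ (n + 1) = a * p ^ n := by
    rw [pow_succ]; field_simp
  rw [mul_pow p (p * z) (n + 1), mul_pow p z (n + 1), mul_pow p z n]
  linear_combination z ^ (n + 1) * h -
    besselCoeff p a (n + 1) * z ^ (n + 1) * (1 - p ^ (n + 1)) * hp

/-- The first order contiguous relation lowering the parameter. -/
lemma besselSeries_contiguous (hp0 : 0 < p) (hp1 : p < 1) (ha0 : 0 < a) (hap : a < p) (z : ℝ) :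
    besselSeries p a z - a / p * besselSeries p a (p * z) =
      (1 - a / p) * besselSeries p (a / p) z := by
  have ha1 := hap.trans hp1
  have hs1 : a / p < 1 := (div_lt_one hp0).2 hap
  have h0 := summable_besselCoeff hp0 hp1 ha0 ha1 z
  have h1 := summable_besselCoeff hp0 hp1 ha0 ha1 (p * z)
  simp only [besselSeries]
  rw [← tsum_mul_left, ← tsum_mul_left, ← h0.tsum_sub (h1.mul_left _)]
  refine tsum_congr fun n => ?_
  have e1 := qPoch_succ (a / p) p n
  rw [qPoch_succ', div_mul_cancel₀ _ hp0.ne'] at e1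
  have h2 := (qPoch_pos hp0 hp1 ha1 n).ne'
  have h3 := (qPoch_pos hp0 hp1 hs1 n).ne'
  have key : besselCoeff p a n * (1 - a / p * p ^ n) = (1 - a / p) * besselCoeff p (a / p) n := by
    rw [besselCoeff, besselCoeff, div_mul_eq_mul_div, mul_div_assoc', div_eq_div_iff h2 h3]
    linear_combination -eulerCoeff p n * e1
  rw [mul_pow]
  linear_combination z ^ n * key

/-- The first order contiguous relation raising the parameter. -/
lemma besselSeries_sub (hp0 : 0 < p) (hp1 : p < 1) (ha0 : 0 < a) (ha1 : a < 1) (z : ℝ) :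
    besselSeries p a z - besselSeries p a (p * z) =
      -(p * z / (1 - a)) * besselSeries p (a * p) (p * z) := by
  have h0 := summable_besselCoeff hp0 hp1 ha0 ha1 z
  have h1 := summable_besselCoeff hp0 hp1 ha0 ha1 (p * z)
  simp only [besselSeries]
  rw [← h0.tsum_sub h1, (h0.sub h1).tsum_eq_zero_add, ← tsum_mul_left]
  simp only [pow_zero, sub_self, zero_add]
  refine tsum_congr fun n => ?_
  have h2 := eulerCoeff_succ hp0 hp1 n
  have hap : a * p < 1 := mul_lt_one_of_nonneg_of_lt_one_left ha0.le ha1 hp1.le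
  have h3 := (qPoch_pos hp0 hp1 hap n).ne'
  have h4 : 1 - a ≠ 0 := by linarith
  rw [besselCoeff, besselCoeff, qPoch_succ', mul_pow p z (n + 1), mul_pow p z n]
  field_simp
  linear_combination z ^ (n + 1) * h2

/-- The transformation exchanging the parameter and the argument of `₁φ₁`. -/
theorem qPochInf_mul_besselSeries (hp0 : 0 < p) (hp1 : p < 1) (ha0 : 0 < a) (ha1 : a < 1)
    (z : ℝ) : qPochInf a p * besselSeries p a z =
      ∑' i : ℕ, eulerCoeff p i * (a / p) ^ i * qPochInf (p * (p ^ i * z)) p := by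
  -- Expanding `(a p^n; p)_∞` by Euler gives a double series; summing over `n` first is Euler's
  -- expansion again.
  set f : ℕ → ℕ → ℝ := fun n i =>
    eulerCoeff p n * z ^ n * (eulerCoeff p i * (a / p * p ^ n) ^ i) with hf
  have hsum : Summable (Function.uncurry f) := by
    have h1 := summable_abs_eulerCoeff hp0 hp1 (abs_nonneg z)
    have h2 := summable_abs_eulerCoeff hp0 hp1 (div_pos ha0 hp0).le
    refine Summable.of_norm (Summable.of_nonneg_of_le (fun _ => norm_nonneg _) ?_
      (h1.mul_of_nonneg h2 (fun _ => by positivity) (fun _ => by positivity)))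
    rintro ⟨n, i⟩
    simp only [Function.uncurry, hf, Real.norm_eq_abs, abs_mul, abs_pow, abs_of_pos ha0,
      abs_of_pos hp0, abs_div]
    gcongr
    exact mul_le_of_le_one_right (by positivity) (pow_le_one₀ hp0.le hp1.le)
  calc qPochInf a p * besselSeries p a z = ∑' n, ∑' i, f n i := by
        rw [besselSeries, ← tsum_mul_left]
        refine tsum_congr fun n => ?_
        rw [hf]
        simp only
        rw [tsum_mul_left, tsum_eulerCoeff hp0 hp1, ← mul_assoc p, mul_div_cancel₀ _ hp0.ne',
          ← qPoch_mul_qPochInf hp0 hp1 a n, besselCoeff]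
        have := (qPoch_pos hp0 hp1 ha1 n).ne'
        field_simp
    _ = ∑' i, ∑' n, f n i := (hsum.tsum_comm).symm
    _ = _ := by
        refine tsum_congr fun i => ?_
        rw [← tsum_eulerCoeff hp0 hp1, ← tsum_mul_left]
        refine tsum_congr fun n => ?_
        rw [hf]
        simp only [mul_pow, ← pow_mul, mul_comm n i]
        ring

/-! ### The function `₁φ₁(0; a; p, p z)` on the lattice `z = p^m` -/

lemma qPochInf_mul_besselSeries_zpow (hp0 : 0 < p) (hp1 : p < 1) (ha0 : 0 < a) (ha1 : a < 1)
    (m : ℤ) : qPochInf a p * besselSeries p a (p ^ m) =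
      ∑' i : ℕ, eulerCoeff p i * (a / p) ^ i * qPochInf (p ^ (1 + (i + m))) p := by
  rw [qPochInf_mul_besselSeries hp0 hp1 ha0 ha1]
  refine tsum_congr fun i => ?_
  rw [zpow_add₀ hp0.ne', zpow_add₀ hp0.ne', zpow_one, zpow_natCast]

lemma abs_eulerCoeff_mul_qPochInf_le (hp0 : 0 < p) (hp1 : p < 1) (ha0 : 0 < a) (i : ℕ) (j : ℤ) :
    |eulerCoeff p i * (a / p) ^ i * qPochInf (p ^ j) p| ≤ |eulerCoeff p i| * (a / p) ^ i := by
  have h := qPochInf_zpow_mem hp0 hp1 j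
  rw [abs_mul, abs_mul, abs_of_nonneg h.1, abs_of_pos (by positivity : 0 < (a / p) ^ i)]
  exact mul_le_of_le_one_right (by positivity) h.2

lemma abs_of_pos_mul {x : ℝ} (hx : 0 < x) (y : ℝ) : |x * y| = x * |y| := by
  rw [abs_mul, abs_of_pos hx]

lemma exists_abs_besselSeries_le (hp0 : 0 < p) (hp1 : p < 1) (ha0 : 0 < a) (ha1 : a < 1) :
    ∃ C, ∀ m : ℤ, |besselSeries p a (p ^ m)| ≤ C := by
  have hP := qPochInf_pos hp0 hp1 ha1
  have hs := summable_abs_eulerCoeff hp0 hp1 (div_pos ha0 hp0).le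
  refine ⟨(qPochInf a p)⁻¹ * ∑' i : ℕ, |eulerCoeff p i| * (a / p) ^ i, fun m => ?_⟩
  rw [← div_eq_inv_mul, le_div_iff₀ hP, mul_comm, ← abs_of_pos_mul hP,
    qPochInf_mul_besselSeries_zpow hp0 hp1 ha0 ha1, ← Real.norm_eq_abs]
  exact tsum_of_norm_bounded hs.hasSum fun i => abs_eulerCoeff_mul_qPochInf_le hp0 hp1 ha0 i _

/-- In the transformed series at `p^(-k)` the terms with `i < k` vanish, so the quadratic exponent
of the coefficient starts at index `k`. -/
lemma exists_abs_besselSeries_neg_le (hp0 : 0 < p) (hp1 : p < 1) (ha0 : 0 < a) (ha1 : a < 1) :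
    ∃ C, ∀ k : ℕ, |besselSeries p a (p ^ (-(k : ℤ)))| ≤
      C * (p ^ (k * (k + 1) / 2) * (a / p) ^ k) := by
  have hP := qPochInf_pos hp0 hp1 ha1
  have hPp := qPochInf_pos hp0 hp1 hp1
  have hs := (summable_geometric_of_lt_one ha0.le ha1).mul_left (qPochInf p p)⁻¹
  refine ⟨(qPochInf a p)⁻¹ * ∑' i : ℕ, (qPochInf p p)⁻¹ * a ^ i, fun k => ?_⟩
  rw [mul_assoc, ← div_eq_inv_mul, le_div_iff₀ hP, mul_comm, ← abs_of_pos_mul hP,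
    qPochInf_mul_besselSeries_zpow hp0 hp1 ha0 ha1, ← tsum_mul_right]
  have hsummable : Summable fun i : ℕ =>
      eulerCoeff p i * (a / p) ^ i * qPochInf (p ^ (1 + ((i : ℤ) + -(k : ℤ)))) p :=
    Summable.of_norm_bounded (summable_abs_eulerCoeff hp0 hp1 (div_pos ha0 hp0).le)
      fun i => abs_eulerCoeff_mul_qPochInf_le hp0 hp1 ha0 i _
  rw [← hsummable.sum_add_tsum_nat_add k, Finset.sum_eq_zero, zero_add,
    ← Real.norm_eq_abs]
  · refine tsum_of_norm_bounded (hs.mul_right _).hasSum fun i => ?_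
    refine (abs_eulerCoeff_mul_qPochInf_le hp0 hp1 ha0 _ _).trans ?_
    -- The extra `p^i` turns `(a/p)^i` into `a^i`, which is summable.
    have hexp : k * (k + 1) / 2 + i ≤ (i + k) * (i + k + 1) / 2 := by
      induction i with
      | zero => simp
      | succ i ih =>
        have := triangle_succ (i + k)
        rw [show i + 1 + k = i + k + 1 by ring]
        omega
    calc |eulerCoeff p (i + k)| * (a / p) ^ (i + k)
        ≤ (qPochInf p p)⁻¹ * p ^ (k * (k + 1) / 2 + i) * (a / p) ^ (i + k) := by
          gcongr
          refine (abs_eulerCoeff_le hp0 hp1 _).trans ?_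
          gcongr ?_ * ?_
          exact pow_le_pow_of_le_one hp0.le hp1.le hexp
      _ = (qPochInf p p)⁻¹ * a ^ i * (p ^ (k * (k + 1) / 2) * (a / p) ^ k) := by
          rw [pow_add, pow_add, div_pow a p i]
          field_simp
  · intro i hi
    rw [qPochInf_zpow_of_nonpos hp0, mul_zero]
    have := Finset.mem_range.1 hi
    omega

/-- The weight `r` is kept separate from `a` because the telescoping argument needs parameter `a p`
with weight `a`. -/
lemma summable_zpow_mul_besselSeries (hp0 : 0 < p) (hp1 : p < 1) (ha0 : 0 < a) (ha1 : a < 1)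
    {r : ℝ} (har : a ≤ r) (hr1 : r < 1) :
    Summable fun m : ℤ => r ^ m * besselSeries p a (p ^ m) := by
  obtain ⟨C, hC⟩ := exists_abs_besselSeries_le hp0 hp1 ha0 ha1
  obtain ⟨D, hD⟩ := exists_abs_besselSeries_neg_le hp0 hp1 ha0 ha1
  have hr0 := ha0.trans_le har
  refine Summable.of_nat_of_neg ?_ ?_
  · refine Summable.of_norm_bounded ((summable_geometric_of_lt_one hr0.le hr1).mul_right C)
      fun n => ?_
    rw [Real.norm_eq_abs, abs_mul, zpow_natCast, abs_of_pos (by positivity)]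
    gcongr
    exact hC n
  · refine Summable.of_norm_bounded
      ((summable_pow_triangle hp0 hp1 (inv_pos.2 hp0).le).mul_left D) fun n => ?_
    rw [Real.norm_eq_abs, abs_mul, zpow_neg, zpow_natCast, abs_of_pos (by positivity)]
    calc (r ^ n)⁻¹ * |besselSeries p a (p ^ (-(n : ℤ)))|
        ≤ (a ^ n)⁻¹ * (D * (p ^ (n * (n + 1) / 2) * (a / p) ^ n)) := by
          gcongr
          exact hD n
      _ = D * (p ^ (n * (n + 1) / 2) * p⁻¹ ^ n) := by
          rw [div_pow, inv_pow]; field_simp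

/-- The vanishing of the first moment on the lattice. -/
lemma tsum_zpow_mul_besselSeries (hp0 : 0 < p) (hp1 : p < 1) (ha0 : 0 < a) (ha1 : a < 1) :
    ∑' m : ℤ, a ^ m * besselSeries p a (p ^ m) = 0 := by
  -- Multiplied by `(a/p)^m`, the difference equation expresses `a^(m+1) J(p^(m+1))` as a multiple
  -- of `d (m+1) - d m`.
  set d : ℤ → ℝ := fun m =>
    (a / p) ^ m * (besselSeries p a (p ^ m) - besselSeries p a (p * p ^ m)) with hd
  have hshift : ∀ m : ℤ, p * p ^ m = p ^ (m + 1) := fun m => by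
    rw [zpow_add₀ hp0.ne', zpow_one, mul_comm]
  have hds : Summable d := by
    -- By `besselSeries_sub`, `d m` is a constant times the term of index `m + 1` with parameter `a
    -- p` and weight `a`.
    have h := summable_zpow_mul_besselSeries hp0 hp1 (mul_pos ha0 hp0)
      (mul_lt_one_of_nonneg_of_lt_one_left ha0.le ha1 hp1.le)
      (mul_le_of_le_one_right ha0.le hp1.le) ha1
    have h' := ((Equiv.addRight (1 : ℤ)).summable_iff.2 h).mul_left (-(p / a / (1 - a)))
    refine h'.congr fun m => ?_
    have h1a : 1 - a ≠ 0 := by linarith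
    simp only [hd, Function.comp, Equiv.coe_addRight]
    rw [besselSeries_sub hp0 hp1 ha0 ha1, hshift, zpow_add₀ ha0.ne', zpow_one, div_zpow]
    have hpm : p ^ m ≠ 0 := zpow_ne_zero _ hp0.ne'
    rw [← hshift]
    field_simp
  have hds' : Summable fun m : ℤ => d (m + 1) := (Equiv.addRight (1 : ℤ)).summable_iff.2 hds
  have hsum : ∑' m : ℤ, d (m + 1) = ∑' m : ℤ, d m := (Equiv.addRight (1 : ℤ)).tsum_eq d
  have hterm : ∀ m : ℤ, a ^ (m + 1) * besselSeries p a (p ^ (m + 1)) =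
      a / p * (d (m + 1) - d m) := by
    intro m
    have hrec := besselSeries_recurrence hp0 hp1 ha0 ha1 (p ^ m)
    have hpm : p ^ m ≠ 0 := zpow_ne_zero _ hp0.ne'
    simp only [hd]
    rw [← hshift, zpow_add₀ (div_pos ha0 hp0).ne', zpow_add₀ ha0.ne', zpow_one, zpow_one]
    have ham : a ^ m = (a / p) ^ m * p ^ m := by rw [div_zpow]; field_simp
    have hap : a = a / p * p := by field_simp
    rw [ham]
    linear_combination (a / p) * (a / p) ^ m * hrec +
      (a / p) ^ m * p ^ m * besselSeries p a (p * p ^ m) * hap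
  rw [← (Equiv.addRight (1 : ℤ)).tsum_eq fun m : ℤ => a ^ m * besselSeries p a (p ^ m)]
  simp only [Equiv.coe_addRight, hterm]
  rw [tsum_mul_left, hds'.tsum_sub hds, hsum, sub_self, mul_zero]

end

/-! ### The sum defining the `q`-Macdonald function -/

/-- The bilateral sum `∑_k a^k / (1 + p^k) J(p^{k-N})` defining the `q`-Macdonald function. -/
def macdonaldSum (p a : ℝ) (N : ℤ) : ℝ :=
  ∑' k : ℤ, a ^ k * (1 + p ^ k)⁻¹ * besselSeries p a (p ^ (k - N))

section

variable {p a : ℝ}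

lemma inv_one_add_zpow_mem (hp0 : 0 < p) (k : ℤ) :
    0 < (1 + p ^ k)⁻¹ ∧ (1 + p ^ k)⁻¹ ≤ 1 := by
  have h : 0 < p ^ k := zpow_pos hp0 k
  exact ⟨by positivity, inv_le_one_of_one_le₀ (by linarith)⟩

lemma zpow_mul_besselSeries_sub (ha0 : 0 < a) (N k : ℤ) :
    a ^ k * besselSeries p a (p ^ (k - N)) =
      a ^ N * (a ^ (k - N) * besselSeries p a (p ^ (k - N))) := by
  rw [← mul_assoc, ← zpow_add₀ ha0.ne']
  ring_nf

lemma summable_zpow_mul_besselSeries_sub (hp0 : 0 < p) (hp1 : p < 1) (ha0 : 0 < a) (ha1 : a < 1)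
    (N : ℤ) : Summable fun k : ℤ => a ^ k * besselSeries p a (p ^ (k - N)) :=
  (((Equiv.subRight N).summable_iff.2
    (summable_zpow_mul_besselSeries hp0 hp1 ha0 ha1 le_rfl ha1)).mul_left (a ^ N)).congr
      fun k => (zpow_mul_besselSeries_sub ha0 N k).symm

lemma tsum_zpow_mul_besselSeries_sub (hp0 : 0 < p) (hp1 : p < 1) (ha0 : 0 < a) (ha1 : a < 1)
    (N : ℤ) : ∑' k : ℤ, a ^ k * besselSeries p a (p ^ (k - N)) = 0 := by
  rw [tsum_congr (zpow_mul_besselSeries_sub ha0 N), tsum_mul_left]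
  have h := (Equiv.subRight N).tsum_eq fun m : ℤ => a ^ m * besselSeries p a (p ^ m)
  simp only [Equiv.subRight_apply] at h
  rw [h, tsum_zpow_mul_besselSeries hp0 hp1 ha0 ha1, mul_zero]

lemma summable_macdonaldSum (hp0 : 0 < p) (hp1 : p < 1) (ha0 : 0 < a) (ha1 : a < 1) (N : ℤ) :
    Summable fun k : ℤ => a ^ k * (1 + p ^ k)⁻¹ * besselSeries p a (p ^ (k - N)) := by
  refine Summable.of_norm_bounded
    (summable_zpow_mul_besselSeries_sub hp0 hp1 ha0 ha1 N).norm fun k => ?_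
  have h := inv_one_add_zpow_mem hp0 k
  rw [mul_right_comm, norm_mul, Real.norm_of_nonneg h.1.le]
  exact mul_le_of_le_one_right (norm_nonneg _) h.2

/-- Shifting `k` by `N` extracts `a^N`, and the weight `1/(1+p^k)` is at most one. -/
lemma exists_abs_macdonaldSum_le (hp0 : 0 < p) (hp1 : p < 1) (ha0 : 0 < a) (ha1 : a < 1) :
    ∃ B, ∀ N : ℤ, |macdonaldSum p a N| ≤ B * a ^ N := by
  have hs := (summable_zpow_mul_besselSeries hp0 hp1 ha0 ha1 le_rfl ha1).norm
  refine ⟨∑' m : ℤ, ‖a ^ m * besselSeries p a (p ^ m)‖, fun N => ?_⟩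
  rw [← Real.norm_eq_abs, ← (Equiv.subRight N).tsum_eq, mul_comm, ← tsum_mul_left]
  refine tsum_of_norm_bounded
    (((Equiv.subRight N).summable_iff.2 hs).mul_left (a ^ N)).hasSum fun k => ?_
  have h := inv_one_add_zpow_mem hp0 k
  rw [mul_right_comm, zpow_mul_besselSeries_sub ha0 N k, norm_mul, Real.norm_of_nonneg h.1.le,
    norm_mul, Real.norm_of_nonneg (zpow_pos ha0 N).le]
  exact mul_le_of_le_one_right (by positivity) h.2

lemma tendsto_macdonaldSum (hp0 : 0 < p) (hp1 : p < 1) (ha0 : 0 < a) (ha1 : a < 1) (M : ℤ) :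
    Tendsto (fun j : ℕ => macdonaldSum p a (M + j)) atTop (𝓝 0) := by
  obtain ⟨B, hB⟩ := exists_abs_macdonaldSum_le hp0 hp1 ha0 ha1
  refine squeeze_zero_norm (fun j => hB (M + j)) ?_
  have h := (tendsto_pow_atTop_nhds_zero_of_lt_one ha0.le ha1).const_mul (B * a ^ M)
  rw [mul_zero] at h
  refine h.congr fun j => ?_
  rw [zpow_add₀ ha0.ne', zpow_natCast, mul_assoc]

/-- The weight `p^k / (1 + p^k)` gives the negative of the sum, by the vanishing of the first
moment. -/
lemma hasSum_compl_weight (hp0 : 0 < p) (hp1 : p < 1) (ha0 : 0 < a) (ha1 : a < 1) (N : ℤ) :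
    HasSum (fun k : ℤ => a ^ k * p ^ k * (1 + p ^ k)⁻¹ * besselSeries p a (p ^ (k - N)))
      (-macdonaldSum p a N) := by
  have h := (summable_zpow_mul_besselSeries_sub hp0 hp1 ha0 ha1 N).hasSum.sub
    (summable_macdonaldSum hp0 hp1 ha0 ha1 N).hasSum
  rw [tsum_zpow_mul_besselSeries_sub hp0 hp1 ha0 ha1, zero_sub] at h
  refine h.congr_fun fun k => ?_
  have : 1 + p ^ k ≠ 0 := by have := zpow_pos hp0 k; positivity
  field_simp
  ring

/-- The modified second order `q`-difference equation. -/
theorem macdonaldSum_recurrence (hp0 : 0 < p) (hp1 : p < 1) (ha0 : 0 < a) (ha1 : a < 1) (N : ℤ) :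
    macdonaldSum p a (N + 1) + a / p * macdonaldSum p a (N - 1) =
      (1 + a / p + p ^ (-N)) * macdonaldSum p a N := by
  have h0 := (summable_macdonaldSum hp0 hp1 ha0 ha1 N).hasSum
  have h1 := (summable_macdonaldSum hp0 hp1 ha0 ha1 (N - 1)).hasSum
  have h2 := (summable_macdonaldSum hp0 hp1 ha0 ha1 (N + 1)).hasSum
  have h := (h0.mul_left (1 + a / p)).sub
    (((hasSum_compl_weight hp0 hp1 ha0 ha1 N).mul_left (p ^ (-N))).add (h1.mul_left (a / p)))
  have key := h.unique (h2.congr_fun fun k => ?_)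
  · simp only [macdonaldSum] at key ⊢
    linear_combination -key
  · have e1 : p * p ^ (k - (N + 1)) = p ^ (k - N) := by
      rw [← zpow_one_add₀ hp0.ne']; ring_nf
    have e2 : p * p ^ (k - N) = p ^ (k - (N - 1)) := by
      rw [← zpow_one_add₀ hp0.ne']; ring_nf
    have e3 : p ^ (k - N) = p ^ (-N) * p ^ k := by
      rw [← zpow_add₀ hp0.ne']; ring_nf
    -- The three arguments of the equation correspond to the sums at `N+1`, `N` and `N-1`.
    have hrec := besselSeries_recurrence hp0 hp1 ha0 ha1 (p ^ (k - (N + 1)))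
    rw [e1, e2] at hrec
    linear_combination -(a ^ k * (1 + p ^ k)⁻¹) * hrec +
      a ^ k * (1 + p ^ k)⁻¹ * besselSeries p a (p ^ (k - N)) * e3

/-- The relation between the sums with parameters `a` and `a / p`. -/
lemma macdonaldSum_contiguous (hp0 : 0 < p) (hp1 : p < 1) (ha0 : 0 < a) (hap : a < p) (N : ℤ) :
    macdonaldSum p a N - a / p * macdonaldSum p a (N - 1) =
      -((1 - a / p) * macdonaldSum p (a / p) N) := by
  have ha1 := hap.trans hp1
  have hs0 := div_pos ha0 hp0
  have hs1 : a / p < 1 := (div_lt_one hp0).2 hap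
  have h0 := (summable_macdonaldSum hp0 hp1 ha0 ha1 N).hasSum
  have h1 := (summable_macdonaldSum hp0 hp1 ha0 ha1 (N - 1)).hasSum
  have h := (hasSum_compl_weight hp0 hp1 hs0 hs1 N).mul_left (1 - a / p)
  have key := (h0.sub (h1.mul_left (a / p))).unique (h.congr_fun fun k => ?_)
  · simp only [macdonaldSum] at key ⊢
    linear_combination key
  · have e2 : p * p ^ (k - N) = p ^ (k - (N - 1)) := by
      rw [← zpow_one_add₀ hp0.ne']; ring_nf
    have e3 : a ^ k = (a / p) ^ k * p ^ k := by
      have : p ^ k ≠ 0 := zpow_ne_zero _ hp0.ne'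
      rw [div_zpow]; field_simp
    have hc := besselSeries_contiguous hp0 hp1 ha0 hap (p ^ (k - N))
    rw [e2] at hc
    rw [e3]
    linear_combination (a / p) ^ k * p ^ k * (1 + p ^ k)⁻¹ * hc

/-- For `p ≤ a` the sum is positive at some integer. -/
lemma exists_macdonaldSum_pos (hp0 : 0 < p) (hp1 : p < 1) (hpa : p ≤ a) (ha1 : a < 1) :
    ∃ N, 0 < macdonaldSum p a N := by
  have ha0 := hp0.trans_le hpa
  obtain ⟨m₀, hm₀⟩ := eventually_atTop.1
    ((tendsto_besselSeries hp0 hp1 ha0 ha1).eventually_const_lt (show (1 / 2 : ℝ) < 1 by norm_num))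
  set J : ℤ → ℝ := fun m => besselSeries p a (p ^ m) with hJ
  have hJ₀ : ∀ m : ℤ, (m₀ : ℤ) ≤ m → 1 / 2 < J m := by
    intro m hm
    lift m to ℕ using (by omega)
    simpa [hJ] using hm₀ m (by omega)
  set s := a / p with hs
  have hs1 : 1 ≤ s := (one_le_div hp0).2 hpa
  -- A summable majorant, independent of `N`, for the terms with `m < m₀`: there `p^m₀ ≤ p^m`, so
  -- `s^m ≤ a^m / p^m₀`.
  set g : ℤ → ℝ := fun m => (p ^ m₀)⁻¹ * ‖a ^ m * J m‖ with hg
  have hgs : Summable g :=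
    (summable_zpow_mul_besselSeries hp0 hp1 ha0 ha1 le_rfl ha1).norm.mul_left _
  -- Since `s ≥ 1`, each of the `n` terms with `m₀ ≤ m < m₀ + n` is at least `1/4`; together they
  -- outweigh `∑ g`.
  obtain ⟨n, hn⟩ := exists_nat_gt (4 * ∑' m, g m)
  set N : ℕ := m₀ + n with hN
  set f : ℤ → ℝ := fun m => s ^ m * (1 + p ^ ((N : ℤ) - m))⁻¹ * J m with hf
  have hfF : HasSum f (s ^ N * macdonaldSum p a (-N)) := by
    have h := (((Equiv.subRight (N : ℤ)).hasSum_iff.2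
      (summable_macdonaldSum hp0 hp1 ha0 ha1 (-N)).hasSum).mul_left (s ^ N))
    refine h.congr_fun fun m => ?_
    simp only [hf, hJ, Function.comp, Equiv.subRight_apply, sub_neg_eq_add, sub_add_cancel]
    have e1 : p ^ ((N : ℤ) - m) = (p ^ (m - (N : ℤ)))⁻¹ := by
      rw [← zpow_neg]; ring_nf
    have e2 : s ^ m = s ^ N * (a ^ (m - (N : ℤ)) * (p ^ (m - (N : ℤ)))⁻¹) := by
      rw [← div_eq_mul_inv, ← div_zpow, ← zpow_natCast, ← zpow_add₀ (by positivity)]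
      ring_nf
    rw [e1, e2]
    have h1 := zpow_pos hp0 (m - (N : ℤ))
    field_simp
    ring
  have hspos : ∀ m : ℤ, 0 < s ^ m := fun m => zpow_pos (by positivity) m
  have hgnn : ∀ m, 0 ≤ g m := fun m => by positivity
  have hfg : ∀ m, 0 ≤ f m + g m := by
    intro m
    have hw := inv_one_add_zpow_mem hp0 ((N : ℤ) - m)
    rcases le_or_gt (m₀ : ℤ) m with hm | hm
    · have h1 := hJ₀ m hm
      have h2 : 0 ≤ f m := mul_nonneg (mul_nonneg (hspos m).le hw.1.le) (by linarith)
      linarith [hgnn m]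
    · have h1 : |f m| ≤ g m := by
        simp only [hf, hg, norm_mul, abs_mul, abs_of_pos (hspos m), abs_of_pos hw.1,
          abs_of_pos (zpow_pos ha0 m), Real.norm_eq_abs]
        have e : s ^ m ≤ (p ^ m₀)⁻¹ * a ^ m := by
          rw [hs, div_zpow, div_eq_inv_mul]
          have : p ^ m₀ ≤ p ^ m := by
            rw [← zpow_natCast]; exact zpow_le_zpow_right_of_le_one₀ hp0 hp1.le hm.le
          have := zpow_pos ha0 m
          gcongr
        calc s ^ m * (1 + p ^ ((N : ℤ) - m))⁻¹ * |J m| ≤ s ^ m * 1 * |J m| := by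
              gcongr
              exact hw.2
          _ ≤ (p ^ m₀)⁻¹ * a ^ m * 1 * |J m| := by gcongr
          _ = _ := by ring
      linarith [neg_abs_le (f m)]
  have hlow : ∀ i ∈ Finset.range n, (1 / 4 : ℝ) ≤ f (m₀ + i : ℕ) + g (m₀ + i : ℕ) := by
    intro i hi
    have hi' := Finset.mem_range.1 hi
    have h1 := hJ₀ (m₀ + i : ℕ) (by push_cast; omega)
    have h2 : 1 ≤ s ^ ((m₀ + i : ℕ) : ℤ) := by
      rw [zpow_natCast]; exact one_le_pow₀ hs1
    have h3 : (1 / 2 : ℝ) ≤ (1 + p ^ ((N : ℤ) - (m₀ + i : ℕ)))⁻¹ := by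
      rw [one_div]
      have h4 : p ^ ((N : ℤ) - (m₀ + i : ℕ)) ≤ 1 :=
        zpow_le_one₀ hp0 hp1.le (by rw [hN]; push_cast; omega)
      have h5 := zpow_pos hp0 ((N : ℤ) - (m₀ + i : ℕ))
      gcongr
      linarith
    have h6 : (1 : ℝ) * (1 / 2) * (1 / 2) ≤ f (m₀ + i : ℕ) := by
      simp only [hf]
      gcongr
    linarith [hgnn (m₀ + i : ℕ)]
  have hsum := sum_le_hasSum ((Finset.range n).image fun i : ℕ => ((m₀ + i : ℕ) : ℤ))
    (fun m _ => hfg m) (hfF.add hgs.hasSum)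
  rw [Finset.sum_image (fun i _ j _ h => by simpa using h)] at hsum
  have hcard := Finset.card_nsmul_le_sum _ _ _ hlow
  rw [Finset.card_range, nsmul_eq_mul] at hcard
  refine ⟨-N, ?_⟩
  have : 0 < s ^ N * macdonaldSum p a (-N) := by linarith
  exact pos_of_mul_pos_right this (by positivity)

/-- If the sum vanished for every `N` at parameter `a < p`, the contiguous relation would make it
vanish at `a/p`. Finitely many divisions by `p` bring the parameter into `[p, 1)`. -/
lemma exists_macdonaldSum_ne_zero (hp0 : 0 < p) (hp1 : p < 1) (ha0 : 0 < a) (ha1 : a < 1) :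
    ∃ N, macdonaldSum p a N ≠ 0 := by
  obtain ⟨n, hn⟩ := exists_pow_lt_of_lt_one ha0 hp1
  induction n generalizing a with
  | zero => simp only [pow_zero] at hn; linarith
  | succ n ih =>
    rcases le_or_gt p a with hpa | hap
    · exact (exists_macdonaldSum_pos hp0 hp1 hpa ha1).imp fun _ h => h.ne'
    · have hs1 : a / p < 1 := (div_lt_one hp0).2 hap
      obtain ⟨N, hN⟩ := ih (div_pos ha0 hp0) hs1 (by rwa [lt_div_iff₀ hp0, ← pow_succ])
      by_contra! h
      have := macdonaldSum_contiguous hp0 hp1 ha0 hap N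
      rw [h, h, mul_zero, sub_zero, eq_comm, neg_eq_zero, mul_eq_zero] at this
      exact this.elim (fun h => by linarith) hN

end

/-! ### Decaying solutions of the modified equation -/

section

variable {f b : ℤ → ℝ} {s : ℝ}

/-- The recurrence reads `f(M+1) - f M = s (f M - f(M-1)) + b M f M`. A nonnegative increment at a
positive value therefore persists, which contradicts decay. -/
lemma lt_pred_of_pos (hs : 0 < s) (hb : ∀ M, 0 < b M)
    (hrec : ∀ M, f (M + 1) + s * f (M - 1) = (1 + s + b M) * f M)
    (hlim : ∀ M, Tendsto (fun j : ℕ => f (M + j)) atTop (𝓝 0)) {M : ℤ} (hM : 0 < f M) :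
    f M < f (M - 1) := by
  by_contra! h
  have key : ∀ j : ℕ, f M ≤ f (M + j) ∧ f (M + j - 1) ≤ f (M + j) := by
    intro j
    induction j with
    | zero => simpa using h
    | succ j ih =>
      have h1 := hrec (M + j)
      have h2 : 0 < b (M + j) * f (M + j) := mul_pos (hb _) (hM.trans_le ih.1)
      have h3 : f (M + j) ≤ f (M + j + 1) := by nlinarith [ih.2]
      push_cast
      rw [← add_assoc, add_sub_cancel_right]
      exact ⟨ih.1.trans h3, h3⟩
  exact absurd (ge_of_tendsto' (hlim M) fun j => (key j).1) (not_le.2 hM)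

/-- A decaying solution of `f (M + 1) + s f (M - 1) = (1 + s + b M) f M` that does not vanish
identically is of strictly constant sign. -/
lemma pos_or_neg_of_recurrence (hs : 0 < s) (hb : ∀ M, 0 < b M)
    (hrec : ∀ M, f (M + 1) + s * f (M - 1) = (1 + s + b M) * f M)
    (hlim : ∀ M, Tendsto (fun j : ℕ => f (M + j)) atTop (𝓝 0)) (hne : ∃ M, f M ≠ 0) :
    (∀ M, 0 < f M) ∨ ∀ M, f M < 0 := by
  have hrec' : ∀ M, (-f) (M + 1) + s * (-f) (M - 1) = (1 + s + b M) * (-f) M := fun M => by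
    simp only [Pi.neg_apply]; linear_combination -hrec M
  have hlim' : ∀ M, Tendsto (fun j : ℕ => (-f) (M + j)) atTop (𝓝 0) := fun M => by
    simpa using (hlim M).neg
  have hp : ∀ {M}, 0 < f M → 0 < f (M - 1) := fun h => h.trans (lt_pred_of_pos hs hb hrec hlim h)
  have hn : ∀ {M}, f M < 0 → f (M - 1) < 0 := fun {M} h => by
    have := lt_pred_of_pos hs hb hrec' hlim' (M := M) (neg_pos.2 h)
    simp only [Pi.neg_apply] at this
    linarith
  -- Strict signs propagate to the left, so a zero forces a zero on its right; with the recurrence,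
  -- a single zero annihilates `f`.
  have hz : ∀ {M}, f M = 0 → f (M + 1) = 0 := fun {M} h => by
    rcases lt_trichotomy (f (M + 1)) 0 with h1 | h1 | h1
    · have := hn h1; rw [add_sub_cancel_right] at this; linarith
    · exact h1
    · have := hp h1; rw [add_sub_cancel_right] at this; linarith
  have hz' : ∀ {M}, f M = 0 → f (M - 1) = 0 := fun {M} h => by
    have h1 := hrec M
    rw [h, hz h, zero_add, mul_zero] at h1
    exact (mul_eq_zero.1 h1).resolve_left hs.ne'
  have hne' : ∀ M, f M ≠ 0 := by
    intro M hM
    obtain ⟨K, hK⟩ := hne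
    exact hK (Int.inductionOn' K M hM (fun _ _ h => hz h) fun _ _ h => hz' h)
  rcases lt_or_gt_of_ne (hne' 0) with h0 | h0
  · refine Or.inr fun M => Int.inductionOn' M 0 h0 (fun k _ h => ?_) fun k _ h => hn h
    refine (lt_or_gt_of_ne (hne' (k + 1))).resolve_right fun h1 => ?_
    have := hp h1
    rw [add_sub_cancel_right] at this
    linarith
  · refine Or.inl fun M => Int.inductionOn' M 0 h0 (fun k _ h => ?_) fun k _ h => hp h
    refine (lt_or_gt_of_ne (hne' (k + 1))).resolve_left fun h1 => ?_
    have := hn h1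
    rw [add_sub_cancel_right] at this
    linarith

/-- Monotonicity `f(M+1) < f M` in the recurrence leaves `(s + b M) f M < s f(M-1)`. -/
lemma mul_lt_of_pos (hs : 0 < s) (hb : ∀ M, 0 < b M)
    (hrec : ∀ M, f (M + 1) + s * f (M - 1) = (1 + s + b M) * f M)
    (hlim : ∀ M, Tendsto (fun j : ℕ => f (M + j)) atTop (𝓝 0)) (hpos : ∀ M, 0 < f M) (M : ℤ) :
    b M * f M < s * f (M - 1) := by
  have h1 := lt_pred_of_pos hs hb hrec hlim (hpos (M + 1))
  rw [add_sub_cancel_right] at h1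
  have := mul_pos hs (hpos M)
  nlinarith [hrec M]

lemma abs_mul_lt_of_recurrence (hs : 0 < s) (hb : ∀ M, 0 < b M)
    (hrec : ∀ M, f (M + 1) + s * f (M - 1) = (1 + s + b M) * f M)
    (hlim : ∀ M, Tendsto (fun j : ℕ => f (M + j)) atTop (𝓝 0)) (hne : ∃ M, f M ≠ 0) (M : ℤ) :
    b M * |f M| < s * |f (M - 1)| := by
  rcases pos_or_neg_of_recurrence hs hb hrec hlim hne with h | h
  · rw [abs_of_pos (h _), abs_of_pos (h _)]
    exact mul_lt_of_pos hs hb hrec hlim h M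
  · rw [abs_of_neg (h _), abs_of_neg (h _)]
    refine mul_lt_of_pos (f := -f) hs hb (fun M => ?_) (fun M => ?_) (fun M => neg_pos.2 (h M)) M
    · simp only [Pi.neg_apply]; linear_combination -hrec M
    · simpa using (hlim M).neg

end

/-! ### The `q`-Macdonald function on the lattice -/

lemma jNorm_eq_besselSeries {q ν : ℝ} (m : ℤ) :
    jNorm ν (q ^ m) (q ^ 2) = besselSeries (q ^ 2) ((q ^ 2) ^ (ν + 1)) ((q ^ 2) ^ m) := by
  refine tsum_congr fun n => ?_
  rw [besselCoeff, eulerCoeff, pow_mul, ← zpow_natCast (q ^ m) 2, ← zpow_mul, ← zpow_natCast q 2,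
    ← zpow_mul, mul_comm m, ← div_div, mul_div_assoc]

lemma qMacdonald_eq_macdonaldSum {q ν : ℝ} (hq0 : 0 < q) (N : ℤ) :
    qMacdonald q ν (q ^ (-N)) =
      cConst q ν * (1 - q) * macdonaldSum (q ^ 2) ((q ^ 2) ^ (ν + 1)) N := by
  rw [qMacdonald, jacksonIntegral, macdonaldSum, ← mul_assoc]
  congr 1
  refine tsum_congr fun k => ?_
  have h1 : q ^ k * q ^ (-N) = q ^ (k - N) := by rw [← zpow_add₀ hq0.ne', sub_eq_add_neg]
  have h2 : (q ^ k) ^ 2 = (q ^ 2) ^ k := by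
    rw [← zpow_natCast (q ^ k) 2, ← zpow_natCast q 2, ← zpow_mul, ← zpow_mul, mul_comm]
  have h3 : q ^ k * (q ^ k) ^ (2 * ν + 1) = ((q ^ 2) ^ (ν + 1)) ^ k := by
    rw [← Real.rpow_intCast, ← Real.rpow_intCast, ← Real.rpow_natCast, ← Real.rpow_mul hq0.le,
      ← Real.rpow_mul hq0.le, ← Real.rpow_mul hq0.le, ← Real.rpow_add hq0]
    congr 1
    push_cast
    ring
  rw [h1, h2, jNorm_eq_besselSeries, ← h3]
  ring

lemma cConst_pos {q ν : ℝ} (hq0 : 0 < q) (hq1 : q < 1) (hν : -1 < ν) : 0 < cConst q ν := by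
  have hp0 : 0 < q ^ 2 := by positivity
  have hp1 : q ^ 2 < 1 := pow_lt_one₀ hq0.le hq1 two_ne_zero
  have h1 := qPochInf_pos hp0 hp1 (Real.rpow_lt_one hq0.le hq1 (by linarith : 0 < 2 * ν + 2))
  have h2 := qPochInf_pos hp0 hp1 hp1
  have h3 : 0 < 1 - q := by linarith
  rw [cConst]
  positivity

end QBessel

end

theorem mainTheorem6 (q ν : ℝ) (hq0 : 0 < q) (hq1 : q < 1) (hν : -1 < ν) :
    ((∀ᶠ n : ℕ in Filter.atTop, 0 < QBessel.qMacdonald q ν (q ^ (-(n : ℤ)))) ∨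
      (∀ᶠ n : ℕ in Filter.atTop, QBessel.qMacdonald q ν (q ^ (-(n : ℤ))) < 0)) ∧
    Filter.Tendsto
      (fun n : ℕ => QBessel.qMacdonald q ν (q ^ (-(n : ℤ))) /
        QBessel.qMacdonald q ν (q ^ (-(n : ℤ) + 1)))
      Filter.atTop (nhds 0) ∧
    ∃ c σ : ℝ, 0 < c ∧ 0 < σ ∧
      ∀ᶠ n : ℕ in Filter.atTop,
        |QBessel.qMacdonald q ν (q ^ (-(n : ℤ)))| < σ * c ^ n * q ^ (n ^ 2) := by
  set p := q ^ 2 with hp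
  set a := p ^ (ν + 1) with ha
  have hp0 : 0 < p := by positivity
  have hp1 : p < 1 := pow_lt_one₀ hq0.le hq1 two_ne_zero
  have ha0 : 0 < a := Real.rpow_pos_of_pos hp0 _
  have ha1 : a < 1 := Real.rpow_lt_one hp0.le hp1 (by linarith)
  set s := a / p with hs
  have hs0 : 0 < s := div_pos ha0 hp0
  set F := QBessel.macdonaldSum p a with hF
  set C := QBessel.cConst q ν * (1 - q) with hC
  have hC0 : 0 < C := mul_pos (QBessel.cConst_pos hq0 hq1 hν) (by linarith)
  have hK : ∀ N : ℤ, QBessel.qMacdonald q ν (q ^ (-N)) = C * F N :=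
    QBessel.qMacdonald_eq_macdonaldSum hq0
  have hK' : ∀ n : ℕ, QBessel.qMacdonald q ν (q ^ (-(n : ℤ) + 1)) = C * F (n - 1) := fun n => by
    rw [← hK, neg_sub, sub_eq_add_neg, add_comm]
  have hb : ∀ M : ℤ, 0 < p ^ (-M) := fun M => zpow_pos hp0 _
  have hrec := QBessel.macdonaldSum_recurrence hp0 hp1 ha0 ha1
  have hlim := QBessel.tendsto_macdonaldSum hp0 hp1 ha0 ha1
  have hne := QBessel.exists_macdonaldSum_ne_zero hp0 hp1 ha0 ha1
  have hsign := QBessel.pos_or_neg_of_recurrence hs0 hb hrec hlim hne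
  have hstep : ∀ n : ℕ, |F n| ≤ s * p ^ n * |F (n - 1)| := fun n => by
    have h := (QBessel.abs_mul_lt_of_recurrence hs0 hb hrec hlim hne n).le
    rw [zpow_neg, zpow_natCast, inv_mul_le_iff₀ (pow_pos hp0 n)] at h
    linarith
  have hFne : ∀ M, F M ≠ 0 := fun M => hsign.elim (fun h => (h M).ne') fun h => (h M).ne
  -- Each step contributes a factor `s`, hence `c = s`; the `+ 1` makes the inequality strict.
  refine ⟨?_, ?_, s, C * |F 0| + 1, hs0, by positivity, Filter.Eventually.of_forall fun n => ?_⟩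
  · simp only [hK]
    exact hsign.imp (fun h => Filter.Eventually.of_forall fun n => mul_pos hC0 (h n))
      fun h => Filter.Eventually.of_forall fun n => mul_neg_of_pos_of_neg hC0 (h n)
  · simp only [hK, hK']
    have h0 := (tendsto_pow_atTop_nhds_zero_of_lt_one hp0.le hp1).const_mul s
    rw [mul_zero] at h0
    refine squeeze_zero_norm (fun n => ?_) h0
    rw [mul_div_mul_left _ _ hC0.ne', norm_div, Real.norm_eq_abs, Real.norm_eq_abs,
      div_le_iff₀ (abs_pos.2 (hFne _))]
    exact hstep n
  · rw [hK, abs_mul, abs_of_pos hC0]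
    have hbound : |F n| ≤ |F 0| * (s ^ n * q ^ n ^ 2) := by
      induction n with
      | zero => simp
      | succ n ih =>
        have h := hstep (n + 1)
        push_cast at h ⊢
        rw [add_sub_cancel_right] at h
        -- As `p = q²`, the left exponent is `n² + 2n + 2`, one more than `(n+1)²`.
        have hpq : p ^ (n + 1) * q ^ n ^ 2 ≤ q ^ (n + 1) ^ 2 := by
          rw [hp, ← pow_mul, ← pow_add]
          exact pow_le_pow_of_le_one hq0.le hq1.le (by nlinarith)
        calc |F (n + 1)| ≤ s * p ^ (n + 1) * |F n| := h
          _ ≤ s * p ^ (n + 1) * (|F 0| * (s ^ n * q ^ n ^ 2)) := by gcongr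
          _ = |F 0| * (s ^ (n + 1) * (p ^ (n + 1) * q ^ n ^ 2)) := by ring
          _ ≤ |F 0| * (s ^ (n + 1) * q ^ (n + 1) ^ 2) := by gcongr
    have hpos : 0 < s ^ n * q ^ n ^ 2 := by positivity
    calc C * |F n| ≤ C * (|F 0| * (s ^ n * q ^ n ^ 2)) := by gcongr
      _ < (C * |F 0| + 1) * s ^ n * q ^ n ^ 2 := by nlinarith
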